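/- All graphs are finite. For positive integers $n\ge 2d$, let $K_{n/d}$ be the graph on $\{0,\dots,n-1\}$ in which $i,j$ are adjacent iff $d\le |i-j|\le n-d$. The circular chromatic number of a graph $H$ (possibly with loops) is $\chi_c(H)=\inf\{n/d : \text{there is a homomorphism } H\to K_{n/d}\}$, with $\inf\varnothing=+\infty$ (so $\chi_c(H)=+\infty$ if $H$ has a loop). For a simple graph $G$ and a positive integer $m$, let $G^{1/m}$ be the graph obtained from $G$ by replacing each edge with a path with $m$ edges; for a positive integer $k$, let $G^{k/m}$ be the graph on the vertex set of $G^{1/m}$ in which $u$ and $v$ (possibly equal) are joined iff there is a walk of length exactly $k$ from $u$ to $v$ in $G^{1/m}$. Theorem. Let $G$ be a finite simple non-bipartite graph, and let $r,s\ge 0$ be integers. Then $\chi_c(G)<\infty$ and $$\chi_c\bigl(G^{\frac{1}{2s+1}}\bigr)=\frac{(2s+1)\,\chi_c(G)}{s\,\chi_c(G)+1}.$$ Moreover, if $\chi_c\bigl(G^{\frac{2r+1}{2s+1}}\bigr)<4$, then $(s-r)\chi_c(G)+2r+1>0$ and $$\chi_c\bigl(G^{\frac{2r+1}{2s+1}}\bigr)=\frac{(2s+1)\,\chi_c(G)}{(s-r)\,\chi_c(G)+2r+1}.$$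 -/

import Mathlib

/-- Adjacency of the circular complete graph `K_{n/d}` on `{0, …, n - 1}`:
`i` and `j` are adjacent iff `d ≤ |i - j| ≤ n - d` (used for `0 < d`, `2 * d ≤ n`). -/
def circularCompleteAdj (n d : ℕ) (i j : Fin n) : Prop :=
  (d : ℤ) ≤ |(i : ℤ) - (j : ℤ)| ∧ |(i : ℤ) - (j : ℤ)| ≤ (n : ℤ) - (d : ℤ)

/-- The circular chromatic number: the infimum of all `n / d` such that there is a homomorphism
to `K_{n/d}`. The graph is given by its adjacency relation, so that graphs with loops are covered.
The infimum is taken in `EReal`; it is `⊤` when there is no such homomorphism, as for a graph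
with a loop. -/
noncomputable def circularChromaticNumber {V : Type*} (A : V → V → Prop) : EReal :=
  sInf {x : EReal | ∃ n d : ℕ, 0 < d ∧ 2 * d ≤ n ∧ Nonempty (A →r circularCompleteAdj n d) ∧
    x = (((n : ℝ) / (d : ℝ) : ℝ) : EReal)}

namespace SimpleGraph

/-- Vertices of the `m`-subdivision: the old vertices, and `m - 1` inner vertices for each edge. -/
abbrev SubdivVertex {V : Type*} (G : SimpleGraph V) (m : ℕ) : Type _ :=
  V ⊕ (G.edgeSet × Fin (m - 1))

/-- The `i`-th vertex, `0 ≤ i ≤ m`, of the path with `m` edges that replaces the edge `e`.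
The path runs between the two ends of `e`, in a chosen direction, and its inner vertices are
`(e, 0), …, (e, m - 2)`. -/
noncomputable def subdivPath {V : Type*} (G : SimpleGraph V) (m : ℕ) (e : G.edgeSet) (i : ℕ) :
    G.SubdivVertex m :=
  if i = 0 then Sum.inl (Quot.out e.1).1
  else if h : i - 1 < m - 1 then Sum.inr (e, ⟨i - 1, h⟩)
  else Sum.inl (Quot.out e.1).2

/-- The graph `G^{1/m}`, for `1 ≤ m`: every edge of `G` is replaced by a path with `m` edges. -/
noncomputable def subdivision {V : Type*} (G : SimpleGraph V) (m : ℕ) :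
    SimpleGraph (G.SubdivVertex m) :=
  SimpleGraph.fromRel fun x y =>
    ∃ e : G.edgeSet, ∃ i < m, x = G.subdivPath m e i ∧ y = G.subdivPath m e (i + 1)

/-- Adjacency of the power `G^k`: `u` and `v` are joined iff there is a walk of length `k` from
`u` to `v`; in particular there is a loop at `u` if there is a closed walk of length `k`
through `u`. -/
def powerAdj {V : Type*} (G : SimpleGraph V) (k : ℕ) (u v : V) : Prop :=
  ∃ w : G.Walk u v, w.length = k

/-- Adjacency of the fractional power `G^{k/m} = (G^{1/m})^k`. -/
def fracPowerAdj {V : Type*} (G : SimpleGraph V) (k m : ℕ) :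
    G.SubdivVertex m → G.SubdivVertex m → Prop :=
  (G.subdivision m).powerAdj k

end SimpleGraph

/-!
Write `T = 1 / 2 - 1 / χ_c`: the least `t` such that the vertices can be placed on the circle
`ℝ / ℤ` with adjacent vertices within `t` of being antipodal. In terms of `T`, fractional powers act
linearly. Subdividing every edge into `2 s + 1` edges divides `T` by `2 s + 1`, as the deviation of
an edge can be spread evenly over the path replacing it. The power `2 r + 1` multiplies `T` by at
most `2 r + 1`. Conversely, a placement for the power with `t < 1 / 4` leaves no room for the
deviations along a walk of length `2 r + 1` to wind around the circle, so that, as real numbers,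
they add up to at least `-t`. After adding `t / (2 r + 1)` to each deviation no such walk has
negative weight, and a shortest-walk potential moves the points so that every edge deviates by at
most `t / (2 r + 1)`.
-/

section UnitAddCircle

theorem exists_coe_eq_and_abs_eq_norm (z : UnitAddCircle) :
    ∃ x : ℝ, (x : UnitAddCircle) = z ∧ |x| = ‖z‖ := by
  obtain ⟨x, rfl⟩ := QuotientAddGroup.mk_surjective z
  refine ⟨x - round x, ?_, UnitAddCircle.norm_eq.symm⟩
  rw [AddCircle.coe_sub, sub_eq_self, AddCircle.coe_eq_zero_iff]
  exact ⟨round x, by simp⟩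

theorem exists_coe_div_eq {n : ℕ} (hn : 0 < n) (z : UnitAddCircle) :
    ∃ x ∈ Set.Ico (0 : ℝ) n, ((x / n : ℝ) : UnitAddCircle) = z := by
  have hn' : (0 : ℝ) < n := by exact_mod_cast hn
  obtain ⟨y, hy, rfl⟩ : z ∈ ((↑) : ℝ → UnitAddCircle) '' Set.Ico 0 (0 + 1) := by
    rw [AddCircle.coe_image_Ico_eq]
    exact Set.mem_univ z
  rw [zero_add] at hy
  refine ⟨y * n, ⟨mul_nonneg hy.1 hn'.le, ?_⟩, by rw [mul_div_cancel_right₀ _ hn'.ne']⟩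
  exact mul_lt_of_lt_one_left hn' hy.2

theorem norm_coe_eq_min_of_abs_le_one {x : ℝ} (hx : |x| ≤ 1) :
    ‖(x : UnitAddCircle)‖ = min |x| (1 - |x|) := by
  wlog h0 : 0 ≤ x generalizing x
  · simpa using this (x := -x) (by simpa using hx) (by linarith)
  rw [abs_of_nonneg h0] at hx ⊢
  rw [UnitAddCircle.norm_eq, abs_sub_round_eq_min]
  rcases hx.lt_or_eq with h1 | rfl
  · rw [Int.fract_eq_self.2 ⟨h0, h1⟩]
  · simp

theorem norm_coe_le_abs (x : ℝ) : ‖(x : UnitAddCircle)‖ ≤ |x| :=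
  QuotientAddGroup.norm_mk_le_norm

theorem abs_le_of_norm_coe_le {x t : ℝ} (hx : |x| < 1 - t) (h : ‖(x : UnitAddCircle)‖ ≤ t) :
    |x| ≤ t := by
  have ht : 0 ≤ t := (norm_nonneg _).trans h
  rw [norm_coe_eq_min_of_abs_le_one (by linarith), min_le_iff] at h
  exact h.resolve_right (by linarith)

theorem le_norm_coe_div_iff {n d x : ℝ} (hn : 0 < n) (hx : |x| ≤ n) :
    d / n ≤ ‖((x / n : ℝ) : UnitAddCircle)‖ ↔ d ≤ |x| ∧ |x| ≤ n - d := by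
  have habs : |x / n| = |x| / n := by rw [abs_div, abs_of_pos hn]
  have hone : 1 - |x| / n = (n - |x|) / n := by rw [sub_div, div_self hn.ne']
  rw [norm_coe_eq_min_of_abs_le_one (habs ▸ (div_le_one hn).2 hx), habs, hone, le_min_iff,
    div_le_div_iff_of_pos_right hn, div_le_div_iff_of_pos_right hn, le_sub_comm]

theorem norm_sub_coe_half (z : UnitAddCircle) :
    ‖z - (1 / 2 : ℝ)‖ = 1 / 2 - ‖z‖ := by
  obtain ⟨x, rfl, hx⟩ := exists_coe_eq_and_abs_eq_norm z
  have hhalf : |x| ≤ 1 / 2 := by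
    simpa [hx] using AddCircle.norm_le_half_period (1 : ℝ) (x := x) one_ne_zero
  obtain ⟨h1, h2⟩ := abs_le.1 hhalf
  have habs : |x - 1 / 2| = 1 / 2 - x := by rw [abs_of_nonpos] <;> linarith
  rw [← AddCircle.coe_sub, norm_coe_eq_min_of_abs_le_one (by linarith), habs, ← hx]
  rcases abs_cases x with h | h <;> grind

theorem coe_half_add_coe_half :
    ((1 / 2 : ℝ) : UnitAddCircle) + ((1 / 2 : ℝ) : UnitAddCircle) = 0 := by
  rw [← AddCircle.coe_add, add_halves, AddCircle.coe_period]

theorem odd_nsmul_coe_half (n : ℕ) :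
    (2 * n + 1) • ((1 / 2 : ℝ) : UnitAddCircle) = ((1 / 2 : ℝ) : UnitAddCircle) := by
  rw [succ_nsmul, mul_nsmul, two_nsmul, coe_half_add_coe_half, smul_zero, zero_add]

end UnitAddCircle

section Floor

variable {a b : ℝ} {k : ℤ}

theorem abs_floor_sub_floor_le (h : |a - b| ≤ k) : |⌊a⌋ - ⌊b⌋| ≤ k := by
  rw [abs_sub_le_iff] at h ⊢
  refine ⟨?_, ?_⟩ <;> rw [sub_le_iff_le_add', ← Int.floor_add_intCast] <;>
    exact Int.floor_le_floor (by linarith)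

theorem le_abs_floor_sub_floor (h : k ≤ |a - b|) : k ≤ |⌊a⌋ - ⌊b⌋| := by
  wlog hab : b ≤ a generalizing a b
  · rw [abs_sub_comm] at h ⊢
    exact this h (le_of_not_ge hab)
  rw [abs_of_nonneg (sub_nonneg.2 hab)] at h
  refine le_trans ?_ (le_abs_self _)
  rw [le_sub_iff_add_le', ← Int.floor_add_intCast]
  exact Int.floor_le_floor (by linarith)

end Floor

/-- The vertices are placed on the circle `ℝ / ℤ` so that related vertices are within distance
`t` of being antipodal. Equivalently, related vertices are at distance at least `1 / 2 - t`, so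
that this is a circular `(1 / 2 - t)⁻¹`-colouring. -/
def IsAntipodalColoring {V : Type*} (A : V → V → Prop) (t : ℝ) (c : V → UnitAddCircle) : Prop :=
  ∀ ⦃u v⦄, A u v → ‖c v - c u - (1 / 2 : ℝ)‖ ≤ t

/-- The infimum of all `t ≥ 0` for which a relation has a `t`-antipodal colouring; if it is less
than `1 / 2`, it is `1 / 2 - 1 / χ`, where `χ` is the circular chromatic number. -/
noncomputable def antipodalDefect {V : Type*} (A : V → V → Prop) : ℝ :=
  sInf {t : ℝ | 0 ≤ t ∧ ∃ c, IsAntipodalColoring A t c}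

section Defect

variable {V W : Type*} {A : V → V → Prop} {B : W → W → Prop} {t : ℝ}

theorem isAntipodalColoring_iff_le_norm {c : V → UnitAddCircle} :
    IsAntipodalColoring A t c ↔ ∀ ⦃u v⦄, A u v → 1 / 2 - t ≤ ‖c v - c u‖ := by
  simp only [IsAntipodalColoring, norm_sub_coe_half, sub_le_comm]

theorem antipodalDefect_nonneg (A : V → V → Prop) : 0 ≤ antipodalDefect A :=
  Real.sInf_nonneg fun _ h => h.1

theorem antipodalDefect_le {c : V → UnitAddCircle} (h0 : 0 ≤ t) (hc : IsAntipodalColoring A t c) :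
    antipodalDefect A ≤ t :=
  csInf_le ⟨0, fun _ h => h.1⟩ ⟨h0, c, hc⟩

theorem exists_isAntipodalColoring_of_antipodalDefect_lt (h : antipodalDefect A < t) :
    ∃ t' < t, 0 ≤ t' ∧ ∃ c, IsAntipodalColoring A t' c := by
  have hne : {t : ℝ | 0 ≤ t ∧ ∃ c, IsAntipodalColoring A t c}.Nonempty :=
    ⟨1 / 2, by norm_num, 0, isAntipodalColoring_iff_le_norm.2 fun _ _ _ => by simp⟩
  obtain ⟨t', ht', hlt⟩ := exists_lt_of_csInf_lt hne h
  exact ⟨t', hlt, ht'⟩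

theorem IsAntipodalColoring.mono {t' : ℝ} {c : V → UnitAddCircle}
    (hc : IsAntipodalColoring A t c) (h : t ≤ t') : IsAntipodalColoring A t' c :=
  fun _ _ huv => (hc huv).trans h

theorem antipodalDefect_le_mul {x : ℝ} (hx : 0 < x)
    (h : ∀ t c, IsAntipodalColoring B t c → ∃ c', IsAntipodalColoring A (x * t) c') :
    antipodalDefect A ≤ x * antipodalDefect B := by
  rw [← div_le_iff₀' hx]
  refine le_of_forall_gt fun t ht => ?_
  obtain ⟨t', htt', h0, c, hc⟩ := exists_isAntipodalColoring_of_antipodalDefect_lt ht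
  obtain ⟨c', hc'⟩ := h t' c hc
  exact ((div_le_iff₀' hx).2 (antipodalDefect_le (by positivity) hc')).trans_lt htt'

theorem antipodalDefect_le_of_hom (φ : A →r B) : antipodalDefect A ≤ antipodalDefect B := by
  simpa using antipodalDefect_le_mul one_pos fun t c hc =>
    ⟨c ∘ φ, fun u v huv => by simpa using hc (φ.map_rel huv)⟩

end Defect

section CircularComplete

variable {V : Type*} {A : V → V → Prop} {n d : ℕ}

theorem circularCompleteAdj_iff_le_norm (i j : Fin n) :
    circularCompleteAdj n d i j ↔
      (d / n : ℝ) ≤ ‖((j / n : ℝ) : UnitAddCircle) - ((i / n : ℝ) : UnitAddCircle)‖ := by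
  have hi : (i : ℝ) < n := by exact_mod_cast i.isLt
  have hj : (j : ℝ) < n := by exact_mod_cast j.isLt
  have habs : |(j - i : ℝ)| ≤ n :=
    abs_sub_le_of_nonneg_of_le (by positivity) hj.le (by positivity) hi.le
  rw [← AddCircle.coe_sub, ← sub_div, le_norm_coe_div_iff ((Nat.cast_nonneg _).trans_lt hi) habs,
    abs_sub_comm]
  constructor <;> exact fun ⟨h1, h2⟩ => ⟨by exact_mod_cast h1, by exact_mod_cast h2⟩

theorem nonempty_hom_circularCompleteAdj_iff (hn : 0 < n) :
    Nonempty (A →r circularCompleteAdj n d) ↔ ∃ c, IsAntipodalColoring A (1 / 2 - d / n) c := by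
  simp only [isAntipodalColoring_iff_le_norm, sub_sub_cancel]
  constructor
  · rintro ⟨φ⟩
    exact ⟨fun v => ((φ v / n : ℝ) : UnitAddCircle), fun u v huv =>
      (circularCompleteAdj_iff_le_norm _ _).1 (φ.map_rel huv)⟩
  · rintro ⟨c, hc⟩
    choose x hx hxc using fun v => exists_coe_div_eq hn (c v)
    have hfloor (v : V) : (⌊x v⌋₊ : ℤ) = ⌊x v⌋ := Int.natCast_floor_eq_floor (hx v).1
    refine ⟨⟨fun v => ⟨⌊x v⌋₊, (Nat.floor_lt (hx v).1).2 (hx v).2⟩, fun {u v} huv => ?_⟩⟩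
    have habs : |x v - x u| ≤ n :=
      abs_sub_le_of_nonneg_of_le (hx v).1 (hx v).2.le (hx u).1 (hx u).2.le
    have hdist := hc huv
    rw [← hxc, ← hxc, ← AddCircle.coe_sub, ← sub_div,
      le_norm_coe_div_iff (by exact_mod_cast hn) habs, abs_sub_comm] at hdist
    simp only [circularCompleteAdj, hfloor]
    exact ⟨le_abs_floor_sub_floor (by exact_mod_cast hdist.1),
      abs_floor_sub_floor_le (by exact_mod_cast hdist.2)⟩

theorem circularCompleteAdj_one_iff (i j : Fin n) : circularCompleteAdj n 1 i j ↔ i ≠ j := by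
  rw [circularCompleteAdj, ne_eq, Fin.ext_iff]
  grind

theorem antipodalDefect_le_of_hom_circularCompleteAdj (hd : 0 < d) (hn : 2 * d ≤ n)
    (φ : A →r circularCompleteAdj n d) : antipodalDefect A ≤ 1 / 2 - d / n := by
  have hn0 : 0 < n := by omega
  have hdn : (d / n : ℝ) ≤ 1 / 2 := by
    rw [div_le_div_iff₀ (by exact_mod_cast hn0) two_pos, one_mul, mul_comm]
    exact_mod_cast hn
  obtain ⟨c, hc⟩ := (nonempty_hom_circularCompleteAdj_iff hn0).1 ⟨φ⟩
  exact antipodalDefect_le (sub_nonneg.2 hdn) hc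

theorem circularChromaticNumber_lt_of_antipodalDefect_lt {x : ℝ} (hx : 0 < x)
    (h : antipodalDefect A < 1 / 2 - x⁻¹) : circularChromaticNumber A < x := by
  obtain ⟨q, hxq, hq⟩ := exists_rat_btwn (lt_sub_comm.1 h)
  have hq0 : (0 : ℝ) < q := (inv_pos.2 hx).trans hxq
  lift q to ℚ≥0 using by exact_mod_cast hq0.le
  rw [Rat.cast_nnratCast] at hxq hq hq0
  have hdn : (q : ℝ) = q.num / q.den := NNRat.cast_def q
  have hd : 0 < q.num := NNRat.num_pos.2 (by exact_mod_cast hq0)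
  have hn : 2 * q.num ≤ q.den := by
    have : (q.num / q.den : ℝ) ≤ 1 / 2 := by linarith [antipodalDefect_nonneg A]
    rw [div_le_div_iff₀ (by exact_mod_cast q.den_pos) two_pos, one_mul, mul_comm] at this
    exact_mod_cast this
  obtain ⟨t, ht, -, c, hc⟩ := exists_isAntipodalColoring_of_antipodalDefect_lt (lt_sub_comm.1 hq)
  have hφ : Nonempty (A →r circularCompleteAdj q.den q.num) :=
    (nonempty_hom_circularCompleteAdj_iff q.den_pos).2 ⟨c, hc.mono (hdn ▸ ht.le)⟩
  refine sInf_lt_iff.2 ⟨_, ⟨q.den, q.num, hd, hn, hφ, rfl⟩, ?_⟩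
  rw [EReal.coe_lt_coe_iff, ← inv_div, ← hdn]
  exact inv_lt_of_inv_lt₀ hx hxq

theorem antipodalDefect_lt_of_circularChromaticNumber_lt {x : ℝ}
    (h : circularChromaticNumber A < x) : 0 < x ∧ antipodalDefect A < 1 / 2 - x⁻¹ := by
  obtain ⟨_, ⟨n, d, hd, hn, ⟨φ⟩, rfl⟩, hx⟩ := sInf_lt_iff.1 h
  rw [EReal.coe_lt_coe_iff] at hx
  have hpos : (0 : ℝ) < n / d := by
    have : 0 < n := by omega
    positivity
  refine ⟨hpos.trans hx, (antipodalDefect_le_of_hom_circularCompleteAdj hd hn φ).trans_lt ?_⟩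
  rw [← inv_div (n : ℝ)]
  gcongr

theorem circularChromaticNumber_eq_inv (h : antipodalDefect A < 1 / 2) :
    circularChromaticNumber A = (((1 / 2 - antipodalDefect A)⁻¹ : ℝ) : EReal) := by
  have hpos : 0 < 1 / 2 - antipodalDefect A := sub_pos.2 h
  apply le_antisymm
  · refine EReal.le_of_forall_lt_iff_le.1 fun x hx => ?_
    rw [EReal.coe_lt_coe_iff] at hx
    have hx0 : 0 < x := (inv_pos.2 hpos).trans hx
    exact (circularChromaticNumber_lt_of_antipodalDefect_lt hx0
      (lt_sub_comm.1 (inv_lt_of_inv_lt₀ hpos hx))).le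
  · refine EReal.le_of_forall_lt_iff_le.1 fun x hx => ?_
    obtain ⟨hx0, hlt⟩ := antipodalDefect_lt_of_circularChromaticNumber_lt hx
    rw [EReal.coe_le_coe_iff]
    exact inv_le_of_inv_le₀ hx0 (lt_sub_comm.1 hlt).le

end CircularComplete

section Walk

open SimpleGraph

variable {V : Type*} {G : SimpleGraph V}

theorem sum_map_darts_sub_sub {M : Type*} [AddCommGroup M] (c : V → M) (a : M) {u v : V}
    (p : G.Walk u v) :
    (p.darts.map fun e => c e.snd - c e.fst - a).sum = c v - c u - p.length • a := by
  induction p with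
  | nil => simp
  | cons h p ih =>
    rw [Walk.darts_cons, List.map_cons, List.sum_cons, ih, Walk.length_cons, succ_nsmul]
    abel

theorem norm_sum_le_length_mul {E : Type*} [SeminormedAddCommGroup E] {l : List E} {t : ℝ}
    (h : ∀ x ∈ l, ‖x‖ ≤ t) : ‖l.sum‖ ≤ l.length * t := by
  calc ‖l.sum‖ ≤ (l.map (‖·‖)).sum := by simpa using norm_multiset_sum_le (l : Multiset E)
    _ ≤ l.length * t := by
      simpa using (l.map (‖·‖)).sum_le_card_nsmul t (List.forall_mem_map.2 h)

theorem powerAdj_symm {k : ℕ} {u v : V} : G.powerAdj k u v → G.powerAdj k v u :=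
  fun ⟨p, hp⟩ => ⟨p.reverse, p.length_reverse.trans hp⟩

theorem powerAdj_odd_mono {i j : ℕ} (hij : i ≤ j) {u v : V} (h : G.powerAdj (2 * i + 1) u v) :
    G.powerAdj (2 * j + 1) u v := by
  induction j, hij using Nat.le_induction with
  | base => exact h
  | succ j _ ih =>
    obtain ⟨_ | ⟨huw, p⟩, hp⟩ := ih
    · simp at hp
    · exact ⟨.cons huw (.cons huw.symm (.cons huw p)), by simpa [mul_add] using hp⟩

theorem powerAdj_odd_of_adj (r : ℕ) {u v : V} (h : G.Adj u v) : G.powerAdj (2 * r + 1) u v :=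
  powerAdj_odd_mono (Nat.zero_le r) ⟨h.toWalk, rfl⟩

/-- `f u` is the least weight of a walk of length at most `n` starting at `u`. -/
theorem exists_potential {w : G.Dart → ℝ} {n : ℕ} (hw : BddBelow (Set.range w))
    (h : ∀ ⦃u v⦄ (p : G.Walk u v), p.length = n + 1 → 0 ≤ (p.darts.map w).sum) :
    ∃ f : V → ℝ, ∀ e : G.Dart, f e.fst ≤ w e + f e.snd := by
  let S (u : V) : Set ℝ := {x | ∃ v, ∃ p : G.Walk u v, p.length ≤ n ∧ (p.darts.map w).sum = x}
  have hnil (u : V) : 0 ∈ S u := ⟨u, .nil, by simp, by simp⟩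
  have hbdd (u : V) : BddBelow (S u) := by
    obtain ⟨b, hb⟩ := hw
    refine ⟨n * min b 0, ?_⟩
    rintro _ ⟨v, p, hp, rfl⟩
    calc n * min b 0 ≤ p.length * min b 0 :=
          mul_le_mul_of_nonpos_right (by exact_mod_cast hp) (min_le_right b 0)
      _ ≤ (p.darts.map w).sum := by
          simpa using (p.darts.map w).card_nsmul_le_sum (min b 0) (List.forall_mem_map.2
            fun e _ => (min_le_left b 0).trans (hb ⟨e, rfl⟩))
  refine ⟨fun u => sInf (S u), fun e => ?_⟩
  rw [← sub_le_iff_le_add']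
  refine le_csInf ⟨0, hnil _⟩ ?_
  rintro _ ⟨v, p, hp, rfl⟩
  rw [sub_le_iff_le_add', ← List.sum_cons, ← List.map_cons]
  rcases hp.lt_or_eq with hlt | heq
  · exact csInf_le (hbdd _) ⟨v, .cons e.adj p, by simpa using hlt, rfl⟩
  · exact (csInf_le (hbdd _) (hnil _)).trans (h (.cons e.adj p) (by simp [heq]))

end Walk

section Power

open SimpleGraph

variable {V : Type*} {G : SimpleGraph V} {t : ℝ} {r : ℕ} {c : V → UnitAddCircle} {δ : G.Dart → ℝ}

theorem IsAntipodalColoring.powerAdj_odd (hc : IsAntipodalColoring G.Adj t c) (r : ℕ) :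
    IsAntipodalColoring (G.powerAdj (2 * r + 1)) ((2 * r + 1) * t) c := by
  rintro u v ⟨p, hp⟩
  have hsum := norm_sum_le_length_mul (l := p.darts.map fun e => c e.snd - c e.fst - (1 / 2 : ℝ))
    (List.forall_mem_map.2 fun e _ => hc e.adj)
  rw [sum_map_darts_sub_sub, hp, odd_nsmul_coe_half, List.length_map, p.length_darts, hp] at hsum
  exact_mod_cast hsum

/-- `δ` assigns to every dart a real representative of the displacement, on the circle `ℝ / ℤ`,
of the colour of its head from the antipode of the colour of its tail. -/
def IsOffsetLift (c : V → UnitAddCircle) (δ : G.Dart → ℝ) : Prop :=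
  ∀ e, (δ e : UnitAddCircle) = c e.snd - c e.fst - (1 / 2 : ℝ)

theorem IsAntipodalColoring.exists_isOffsetLift (hc : IsAntipodalColoring G.Adj t c) :
    ∃ δ : G.Dart → ℝ, IsOffsetLift c δ ∧ ∀ e, |δ e| ≤ t := by
  choose lift hlift hlift_abs using exists_coe_eq_and_abs_eq_norm
  exact ⟨fun e => lift (c e.snd - c e.fst - (1 / 2 : ℝ)), fun _ => hlift _,
    fun e => (hlift_abs _).trans_le (hc e.adj)⟩

theorem IsOffsetLift.symm_eq_neg (hδ : IsOffsetLift c δ) (ht : t < 1 / 2)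
    (hδt : ∀ e, |δ e| ≤ t) (e : G.Dart) : δ e.symm = -δ e := by
  have hcoe : ((δ e.symm + δ e : ℝ) : UnitAddCircle) = 0 := by
    rw [AddCircle.coe_add, hδ, hδ, ← neg_eq_zero, ← coe_half_add_coe_half]
    simp only [Dart.symm, Prod.fst_swap, Prod.snd_swap]
    abel
  have hlt : |δ e.symm + δ e| < 1 := by
    linarith [abs_add_le (δ e.symm) (δ e), hδt e.symm, hδt e]
  rw [← add_eq_zero_iff_eq_neg, ← abs_nonpos_iff]
  exact abs_le_of_norm_coe_le (by linarith) (by rw [hcoe, norm_zero])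

theorem IsOffsetLift.coe_sum_map_darts (hδ : IsOffsetLift c δ) {u v : V} (p : G.Walk u v)
    (hp : p.length = 2 * r + 1) :
    ((p.darts.map δ).sum : UnitAddCircle) = c v - c u - (1 / 2 : ℝ) := by
  have hcoe : ((p.darts.map δ).sum : UnitAddCircle) =
      (p.darts.map fun e => (δ e : UnitAddCircle)).sum := by
    simpa [Function.comp_def] using
      map_list_sum (QuotientAddGroup.mk' (AddSubgroup.zmultiples (1 : ℝ))) (p.darts.map δ)
  rw [hcoe, funext hδ, sum_map_darts_sub_sub, hp, odd_nsmul_coe_half]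

/-- Prepending two edges to a shorter odd walk keeps the sum below `3 / 4 < 1 - t`, so it cannot
have wound around the circle. -/
theorem IsOffsetLift.abs_sum_map_darts_le (hδ : IsOffsetLift c δ) (ht : t < 1 / 4)
    (hδt : ∀ e, |δ e| ≤ t) (hc : IsAntipodalColoring (G.powerAdj (2 * r + 1)) t c)
    {j : ℕ} (hj : j ≤ r) {u v : V} (p : G.Walk u v) (hp : p.length = 2 * j + 1) :
    |(p.darts.map δ).sum| ≤ t := by
  induction j generalizing u v with
  | zero =>
    match p, hp with
    | .cons h .nil, _ => simpa using hδt ⟨(_, _), h⟩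
  | succ j ih =>
    refine abs_le_of_norm_coe_le ?_ ?_
    · match p, hp with
      | .cons h₁ (.cons h₂ q), hp =>
        have hq := ih (by omega) q (by simpa [mul_add] using hp)
        have h₁t := hδt ⟨(_, _), h₁⟩
        have h₂t := hδt ⟨(_, _), h₂⟩
        simp only [Walk.darts_cons, List.map_cons, List.sum_cons]
        rw [abs_le] at hq h₁t h₂t
        rw [abs_lt]
        constructor <;> linarith
    · rw [hδ.coe_sum_map_darts p hp]
      exact hc (powerAdj_odd_mono hj ⟨p, hp⟩)

theorem IsAntipodalColoring.exists_potential_of_powerAdj_odd (ht : t < 1 / 4)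
    (hδ : IsOffsetLift c δ) (hδt : ∀ e, |δ e| ≤ t)
    (hc : IsAntipodalColoring (G.powerAdj (2 * r + 1)) t c) :
    ∃ f : V → ℝ, ∀ e : G.Dart, f e.fst ≤ t / (2 * r + 1) + δ e + f e.snd := by
  refine exists_potential (n := 2 * r) ⟨t / (2 * r + 1) - t, ?_⟩ fun u v p hp => ?_
  · rintro _ ⟨e, rfl⟩
    linarith [neg_le_of_abs_le (hδt e)]
  · have hsum := neg_le_of_abs_le (hδ.abs_sum_map_darts_le ht hδt hc le_rfl p hp)
    rw [List.sum_map_add, List.map_const', List.sum_replicate, p.length_darts, hp, nsmul_eq_mul]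
    push_cast
    rw [mul_div_cancel₀ _ (by positivity)]
    linarith

theorem IsAntipodalColoring.exists_of_powerAdj_odd (ht : t < 1 / 4)
    (hc : IsAntipodalColoring (G.powerAdj (2 * r + 1)) t c) :
    ∃ c', IsAntipodalColoring G.Adj (t / (2 * r + 1)) c' := by
  have hcG : IsAntipodalColoring G.Adj t c := fun _ _ huv => hc (powerAdj_odd_of_adj r huv)
  obtain ⟨δ, hδ, hδt⟩ := hcG.exists_isOffsetLift
  obtain ⟨f, hf⟩ := hc.exists_potential_of_powerAdj_odd ht hδ hδt
  refine ⟨fun v => c v + (f v : UnitAddCircle), fun u v huv => ?_⟩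
  let e : G.Dart := ⟨(u, v), huv⟩
  have hoffset : c v + (f v : UnitAddCircle) - (c u + (f u : UnitAddCircle)) - (1 / 2 : ℝ) =
      ((δ e + f v - f u : ℝ) : UnitAddCircle) := by
    rw [AddCircle.coe_sub, AddCircle.coe_add, hδ e]
    abel
  rw [hoffset]
  refine (norm_coe_le_abs _).trans (abs_le.2 ⟨?_, ?_⟩)
  · linarith [hf e]
  · have hfsymm : f v ≤ t / (2 * r + 1) + δ e.symm + f u := hf e.symm
    linarith [hδ.symm_eq_neg (by linarith) hδt e]

theorem antipodalDefect_powerAdj_odd_le (G : SimpleGraph V) (r : ℕ) :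
    antipodalDefect (G.powerAdj (2 * r + 1)) ≤ (2 * r + 1) * antipodalDefect G.Adj :=
  antipodalDefect_le_mul (by positivity) fun _ c hc => ⟨c, hc.powerAdj_odd r⟩

theorem antipodalDefect_powerAdj_odd (h : antipodalDefect (G.powerAdj (2 * r + 1)) < 1 / 4) :
    antipodalDefect (G.powerAdj (2 * r + 1)) = (2 * r + 1) * antipodalDefect G.Adj := by
  refine le_antisymm (antipodalDefect_powerAdj_odd_le G r) (le_of_forall_gt fun y hy => ?_)
  obtain ⟨t, ht, h0, c, hc⟩ := exists_isAntipodalColoring_of_antipodalDefect_lt (lt_min h hy)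
  obtain ⟨ht4, hty⟩ := lt_min_iff.1 ht
  obtain ⟨c', hc'⟩ := hc.exists_of_powerAdj_odd ht4
  have hle := antipodalDefect_le (by positivity) hc'
  exact ((le_div_iff₀' (by positivity)).1 hle).trans_lt hty

end Power

section Subdivision

open SimpleGraph

variable {V : Type*} {G : SimpleGraph V} {m i : ℕ}

theorem adj_out (e : G.edgeSet) : G.Adj (Quot.out e.1).1 (Quot.out e.1).2 := by
  have hout : s((Quot.out e.1).1, (Quot.out e.1).2) = e.1 := Quot.out_eq e.1
  rw [← mem_edgeSet, hout]
  exact e.2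

theorem subdivPath_zero (m : ℕ) (e : G.edgeSet) :
    G.subdivPath m e 0 = Sum.inl (Quot.out e.1).1 :=
  if_pos rfl

theorem subdivPath_self (hm : 0 < m) (e : G.edgeSet) :
    G.subdivPath m e m = Sum.inl (Quot.out e.1).2 := by
  simp [subdivPath, hm.ne']

theorem subdivPath_succ (hi : i < m - 1) (e : G.edgeSet) :
    G.subdivPath m e (i + 1) = Sum.inr (e, ⟨i, hi⟩) := by
  simp [subdivPath, hi]

theorem subdivPath_ne_succ (hi : i < m) (e : G.edgeSet) :
    G.subdivPath m e i ≠ G.subdivPath m e (i + 1) := by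
  have hne := (adj_out e).ne
  grind [subdivPath]

theorem subdivision_adj_subdivPath (hi : i < m) (e : G.edgeSet) :
    (G.subdivision m).Adj (G.subdivPath m e i) (G.subdivPath m e (i + 1)) :=
  ⟨subdivPath_ne_succ hi e, .inl ⟨e, i, hi, rfl, rfl⟩⟩

theorem powerAdj_subdivision_subdivPath (hi : i ≤ m) (e : G.edgeSet) :
    (G.subdivision m).powerAdj i (G.subdivPath m e 0) (G.subdivPath m e i) := by
  induction i with
  | zero => exact ⟨.nil, rfl⟩
  | succ i ih =>
    obtain ⟨p, hp⟩ := ih (by omega)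
    exact ⟨p.concat (subdivision_adj_subdivPath (by omega) e), by simp [hp]⟩

theorem powerAdj_subdivision_of_adj (hm : 0 < m) {u v : V} (h : G.Adj u v) :
    (G.subdivision m).powerAdj m (Sum.inl u) (Sum.inl v) := by
  let e : G.edgeSet := ⟨s(u, v), G.mem_edgeSet.2 h⟩
  have hout : s((Quot.out e.1).1, (Quot.out e.1).2) = s(u, v) := Quot.out_eq e.1
  have hpath := powerAdj_subdivision_subdivPath (le_refl m) e
  rw [subdivPath_zero, subdivPath_self hm] at hpath
  obtain ⟨h₁, h₂⟩ | ⟨h₁, h₂⟩ := Sym2.eq_iff.1 hout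
  · rwa [h₁, h₂] at hpath
  · rw [h₁, h₂] at hpath
    exact powerAdj_symm hpath

theorem exists_forall_subdivPath_eq {α : Type*} (hm : 0 < m) {c : V → α} {f : G.edgeSet → ℕ → α}
    (hfst : ∀ e, f e 0 = c (Quot.out e.1).1) (hsnd : ∀ e, f e m = c (Quot.out e.1).2) :
    ∃ c' : G.SubdivVertex m → α, ∀ e, ∀ i ≤ m, c' (G.subdivPath m e i) = f e i := by
  refine ⟨Sum.elim c fun x => f x.1 (x.2 + 1), fun e i hi => ?_⟩
  rcases hi.eq_or_lt with rfl | hlt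
  · rw [subdivPath_self hm, Sum.elim_inl, hsnd]
  rcases i with _ | i
  · rw [subdivPath_zero, Sum.elim_inl, hfst]
  · rw [subdivPath_succ (by omega), Sum.elim_inr]

theorem isAntipodalColoring_subdivision_iff {t : ℝ} {c : G.SubdivVertex m → UnitAddCircle} :
    IsAntipodalColoring (G.subdivision m).Adj t c ↔ ∀ e, ∀ i < m,
      ‖c (G.subdivPath m e (i + 1)) - c (G.subdivPath m e i) - (1 / 2 : ℝ)‖ ≤ t := by
  refine ⟨fun hc e i hi => hc (subdivision_adj_subdivPath hi e), fun h => ?_⟩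
  rintro _ _ ⟨-, ⟨e, i, hi, rfl, rfl⟩ | ⟨e, i, hi, rfl, rfl⟩⟩
  · exact h e i hi
  · rw [norm_sub_coe_half, norm_sub_rev, ← norm_sub_coe_half]
    exact h e i hi

/-- The deviation of an edge from being antipodal is spread evenly over the `2 * s + 1` edges
that replace it. -/
theorem IsAntipodalColoring.exists_subdivision_odd {t : ℝ} {c : V → UnitAddCircle}
    (hc : IsAntipodalColoring G.Adj t c) (s : ℕ) :
    ∃ c', IsAntipodalColoring (G.subdivision (2 * s + 1)).Adj (t / (2 * s + 1)) c' := by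
  obtain ⟨δ, hδ, hδt⟩ := hc.exists_isOffsetLift
  let ε (e : G.edgeSet) : ℝ := δ ⟨Quot.out e.1, adj_out e⟩ / (2 * s + 1)
  have hε (e : G.edgeSet) : |ε e| ≤ t / (2 * s + 1) := by
    have hm : (0 : ℝ) < 2 * s + 1 := by positivity
    rw [abs_div, abs_of_pos hm]
    exact div_le_div_of_nonneg_right (hδt _) hm.le
  let step (e : G.edgeSet) : UnitAddCircle := ((1 / 2 : ℝ) : UnitAddCircle) + (ε e : UnitAddCircle)
  have hstep (e : G.edgeSet) :
      c (Quot.out e.1).1 + (2 * s + 1) • step e = c (Quot.out e.1).2 := by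
    have hmul : (2 * s + 1) • (ε e : UnitAddCircle) = δ ⟨Quot.out e.1, adj_out e⟩ := by
      rw [← AddCircle.coe_nsmul, nsmul_eq_mul]
      push_cast
      rw [mul_div_cancel₀ _ (by positivity)]
    rw [nsmul_add, odd_nsmul_coe_half, hmul, hδ]
    abel
  obtain ⟨c', hc'⟩ := exists_forall_subdivPath_eq (m := 2 * s + 1)
    (f := fun e i => c (Quot.out e.1).1 + i • step e) (by omega) (by simp) hstep
  refine ⟨c', isAntipodalColoring_subdivision_iff.2 fun e i hi => ?_⟩
  have hoffset : c' (G.subdivPath _ e (i + 1)) - c' (G.subdivPath _ e i) - (1 / 2 : ℝ) = ε e := by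
    rw [hc' e i hi.le, hc' e (i + 1) hi, succ_nsmul]
    simp only [step]
    abel
  rw [hoffset]
  exact (norm_coe_le_abs _).trans (hε e)

theorem antipodalDefect_subdivision_odd (G : SimpleGraph V) (s : ℕ) :
    antipodalDefect (G.subdivision (2 * s + 1)).Adj = antipodalDefect G.Adj / (2 * s + 1) := by
  apply le_antisymm
  · rw [div_eq_inv_mul]
    refine antipodalDefect_le_mul (by positivity) fun t c hc => ?_
    rw [← div_eq_inv_mul]
    exact hc.exists_subdivision_odd s
  · rw [div_le_iff₀' (by positivity)]
    exact (antipodalDefect_le_of_hom ⟨Sum.inl, powerAdj_subdivision_of_adj (by omega)⟩).trans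
      (antipodalDefect_powerAdj_odd_le _ s)

end Subdivision

theorem antipodalDefect_lt_half_of_colorable {V : Type*} {G : SimpleGraph V} {n : ℕ}
    (hG : G.Colorable n) : antipodalDefect G.Adj < 1 / 2 := by
  obtain ⟨C⟩ := hG.mono (Nat.le_add_right n 2)
  have hle := antipodalDefect_le_of_hom_circularCompleteAdj (n := n + 2) one_pos (by omega)
    ⟨C, fun h => (circularCompleteAdj_one_iff _ _).2 (C.valid h)⟩
  exact hle.trans_lt (sub_lt_self _ (by positivity))

theorem circularChromaticNumber_eq_of_antipodalDefect_eq {V W : Type*} {A : V → V → Prop}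
    {B : W → W → Prop} {r s : ℕ} {χ : ℝ} (hA : antipodalDefect A < 1 / 2)
    (hχ : χ = (1 / 2 - antipodalDefect A)⁻¹) (hB : antipodalDefect B < 1 / 2)
    (h : antipodalDefect B = (2 * r + 1) * (antipodalDefect A / (2 * s + 1))) :
    0 < ((s : ℝ) - r) * χ + 2 * r + 1 ∧ circularChromaticNumber B =
      (((2 * (s : ℝ) + 1) * χ / (((s : ℝ) - r) * χ + 2 * r + 1) : ℝ) : EReal) := by
  have hχ0 : 0 < χ := hχ ▸ inv_pos.2 (sub_pos.2 hA)
  have hdefect : antipodalDefect A = 1 / 2 - χ⁻¹ := by rw [hχ, inv_inv, sub_sub_cancel]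
  have hgap : 1 / 2 - antipodalDefect B =
      (((s : ℝ) - r) * χ + 2 * r + 1) / ((2 * s + 1) * χ) := by
    rw [h, hdefect]
    field_simp
    ring
  refine ⟨?_, by rw [circularChromaticNumber_eq_inv hB, hgap, inv_div]⟩
  have hpos := hgap ▸ sub_pos.2 hB
  exact (div_pos_iff_of_pos_right (by positivity)).1 hpos

theorem mainTheorem1_general {V : Type*} {G : SimpleGraph V} {n : ℕ} (hG : G.Colorable n)
    (r s : ℕ) :
    ∃ χ : ℝ, circularChromaticNumber G.Adj = (χ : EReal) ∧
      circularChromaticNumber (G.subdivision (2 * s + 1)).Adj =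
        (((2 * (s : ℝ) + 1) * χ / ((s : ℝ) * χ + 1) : ℝ) : EReal) ∧
      (circularChromaticNumber (G.fracPowerAdj (2 * r + 1) (2 * s + 1)) < 4 →
        0 < ((s : ℝ) - (r : ℝ)) * χ + 2 * (r : ℝ) + 1 ∧
        circularChromaticNumber (G.fracPowerAdj (2 * r + 1) (2 * s + 1)) =
          (((2 * (s : ℝ) + 1) * χ / (((s : ℝ) - (r : ℝ)) * χ + 2 * (r : ℝ) + 1) : ℝ) : EReal)) := by
  have hlt := antipodalDefect_lt_half_of_colorable hG
  have hsub := antipodalDefect_subdivision_odd G s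
  refine ⟨_, circularChromaticNumber_eq_inv hlt, ?_, fun h4 => ?_⟩
  · have hsub_lt : antipodalDefect (G.subdivision (2 * s + 1)).Adj < 1 / 2 :=
      hsub ▸ (div_le_self (antipodalDefect_nonneg _) (by simp)).trans_lt hlt
    simpa using (circularChromaticNumber_eq_of_antipodalDefect_eq (r := 0) hlt rfl hsub_lt
      (by simpa using hsub)).2
  · obtain ⟨-, hpow_lt⟩ := antipodalDefect_lt_of_circularChromaticNumber_lt (x := 4) h4
    have hpow : antipodalDefect (G.fracPowerAdj (2 * r + 1) (2 * s + 1)) =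
        (2 * r + 1) * antipodalDefect (G.subdivision (2 * s + 1)).Adj :=
      antipodalDefect_powerAdj_odd (hpow_lt.trans_le (by norm_num))
    exact circularChromaticNumber_eq_of_antipodalDefect_eq hlt rfl
      (hpow_lt.trans (by norm_num)) (hsub ▸ hpow)

theorem mainTheorem1 {V : Type*} [Finite V] (G : SimpleGraph V) (hG : ¬ G.IsBipartite)
    (r s : ℕ) :
    ∃ χ : ℝ, circularChromaticNumber G.Adj = (χ : EReal) ∧
      circularChromaticNumber (G.subdivision (2 * s + 1)).Adj =
        (((2 * (s : ℝ) + 1) * χ / ((s : ℝ) * χ + 1) : ℝ) : EReal) ∧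
      (circularChromaticNumber (G.fracPowerAdj (2 * r + 1) (2 * s + 1)) < 4 →
        0 < ((s : ℝ) - (r : ℝ)) * χ + 2 * (r : ℝ) + 1 ∧
        circularChromaticNumber (G.fracPowerAdj (2 * r + 1) (2 * s + 1)) =
          (((2 * (s : ℝ) + 1) * χ / (((s : ℝ) - (r : ℝ)) * χ + 2 * (r : ℝ) + 1) : ℝ) : EReal)) := by
  have := Fintype.ofFinite V
  exact mainTheorem1_general G.colorable_of_fintype r s
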